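/- Let $1\le D<K$ be integers and let $F$ be a field. Consider the one-sided symmetric neighbouring consecutive side-information single unicast index coding problem: there are messages $x_0,\dots,x_{K-1}\in F$ and receivers $R_0,\dots,R_{K-1}$ (subscripts of messages are read modulo $K$); $R_k$ wants $x_k$ and knows $\{x_{k+1},\dots,x_{k+D}\}$. Let $\mathbf L$ be the $K\times(K-D)$ AIR matrix, built recursively. To fill an $m\times n$ block, write $m=qn+r$ with $0\le r<n$ and fill the first $qn$ rows with $q$ copies of $\mathbf I_n$ stacked vertically; if $r>0$, write $n=q'r+r'$ with $0\le r'<r$ and fill the first $q'r$ columns of the remaining $r$ rows with $q'$ copies of $\mathbf I_r$ side by side; if $r'>0$, fill the remaining $r\times r'$ block in the same way. Let $[c_0\,\dots\,c_{K-D-1}]=[x_0\,\dots\,x_{K-1}]\,\mathbf L$ be the broadcast symbols. Put $\lambda_{-1}=K-D$, $\lambda_0=D$ and $\lambda_{i-1}=\beta_i\lambda_i+\lambda_{i+1}$ with $0\le\lambda_{i+1}<\lambda_i$ (division with remainder) for $i=0,1,\dots,l$, where $l$ is the first index with $\lambda_{l+1}=0$. Let $[a:b]$ denote the set of integers from $a$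 to $b$. For $0\le i\le\lceil l/2\rceil$ let $$D_i=[K-D-\lambda_{2i-1}\,:\,K-D-\lambda_{2i-1}+(\beta_{2i}-1)\lambda_{2i}-1]\cap\mathbb Z_{\ge0},$$ and for $0\le i\le\lceil l/2\rceil-1$ let $$E_i=[K-D-\lambda_{2i-1}+(\beta_{2i}-1)\lambda_{2i}\,:\,K-D-\lambda_{2i+1}-1]\cap\mathbb Z_{\ge 0}$$ ($D_i$ is empty if $\lambda_{2i}=0$). For a column $k$, let $d_{down}(k)=k'-k$, where $k'>k$ is the largest row index with $\mathbf L(k',k)=1$; for a row $j$ let $d_{right}(j,k)=k'-k$, where $k'>k$ is the smallest column index with $\mathbf L(j,k')=1$. Let $\mu_k=d_{right}(k+d_{down}(k),k)$, let $p_k$ be the number of $1$s in column $k+\mu_k$ below $\mathbf L(k+d_{down}(k),k+\mu_k)$, and let $t_{k,1}<\dots<t_{k,p_k}$ be their distances from this entry. Write $$S_i(n)=\sum_{z=1}^{i}\sum_{j=1}^{\beta_{2z-1}}x_{n+D-\lambda_{2z-2}+j\lambda_{2z-1}} .$$ Then every $k\in[0:K-1]$ falls in one of the following four cases, and $R_k$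 recovers $x_k$ as stated; every term $\nu$ below is a function of the side-information of $R_k$ alone. If $F$ has characteristic $2$ (in particular $F=\mathbb F_2$), all minus signs may be replaced by plus signs and the sums are exclusive ORs. (i) If $k\in D_i$ for some $i\in[0:\lceil l/2\rceil]$, then $d_{down}(k)$ and $\mu_k$ are defined, $k+\mu_k<K-D$, and $$x_k=c_k-c_{k+\mu_k}-\nu_k+\nu_{k+\mu_k},\qquad \nu_k=S_i(k),\quad \nu_{k+\mu_k}=x_{k+\mu_k}+S_i(k+\mu_k).$$ (ii) If $k\in E_i$ for some $i\in[0:\lceil l/2\rceil-1]$, then $d_{down}(k)$ and $\mu_k$ are defined, $k+\mu_k<K-D$, $k+t_{k,r}<K-D$ for all $r$, and $$x_k=c_k-c_{k+\mu_k}+\sum_{r=1}^{p_k}c_{k+t_{k,r}}-\nu_k+\nu_{k+\mu_k}-\sum_{r=1}^{p_k}\nu_{k+t_{k,r}},$$ where $\nu_k=S_i(k)$, $\nu_{k+t_{k,r}}=x_{k+t_{k,r}}+S_i(k+t_{k,r})$, $$\nu_{k+\mu_k}=x_{k+\mu_k}+S_i(k+\mu_k)+\sum_{j=1}^{c}x_{k+\mu_k+D-\lambda_{2i}+j\lambda_{2i+1}},$$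 and $c\ge0$ is the integer with $k-(K-D-\lambda_{2i-1})=(\beta_{2i}-1)\lambda_{2i}+c\lambda_{2i+1}+d$, $0\le d<\lambda_{2i+1}$. (iii) If $k\in[K-D-\lambda_l:K-D-1]$, then $x_k=c_k-\nu_k$, where $\nu_k=S_{\lceil l/2\rceil}(k)$ if $l$ is odd and $\nu_k=x_{k+D}+S_{\lceil l/2\rceil}(k)$ if $l$ is even. (iv) If $k\in[K-D:K-1]$, put $k'=k \bmod (K-D)$. Then $x_k=c_{k'}-\nu_{k'}$, where $\nu_{k'}$ is the sum of all message symbols present in $c_{k'}$ except $x_k$. -/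

import Mathlib

namespace AIR

/-- The `(i, j)` entry (rows and columns counted from `0`) of the AIR matrix with `m` rows and `n`
columns. Write `m = q * n + r` with `r < n`: the first `q * n` rows are filled with `q` identity
matrices of size `n`, one below the other. If `r ≠ 0`, write `n = q' * r + r'` with `r' < r`: the
first `q' * r` columns of the remaining `r` rows are filled with `q'` identity matrices of size `r`,
side by side. The remaining `r × r'` block is filled in the same way. -/
def entry (m n i j : ℕ) : ℕ :=
  if _hn : n = 0 then 0
  else if i < (m / n) * n then (if i % n = j then 1 else 0)
  else if _hr : m % n = 0 then 0
  else if j < (n / (m % n)) * (m % n) then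
    (if j % (m % n) = i - (m / n) * n then 1 else 0)
  else entry (m % n) (n % (m % n)) (i - (m / n) * n) (j - (n / (m % n)) * (m % n))
termination_by n
decreasing_by
  exact lt_trans (Nat.mod_lt _ (Nat.pos_of_ne_zero _hr)) (Nat.mod_lt _ (Nat.pos_of_ne_zero _hn))

/-- The `K × (K - D)` AIR matrix `L` over `F`. -/
def airMatrix (F : Type*) [Field F] (K D : ℕ) : Matrix (Fin K) (Fin (K - D)) F :=
  Matrix.of fun i j => (entry K (K - D) i j : F)

/-- The broadcast symbols `[c_0 … c_{K-D-1}] = [x_0 … x_{K-1}] L`. -/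
def code {F : Type*} [Field F] (K D : ℕ) (x : Fin K → F) : Fin (K - D) → F :=
  Matrix.vecMul x (airMatrix F K D)

/-- The broadcast symbol `c_n`, for a natural number `n < K - D` (and `0` for other `n`). -/
def sym {F : Type*} [Field F] (K D : ℕ) (x : Fin K → F) (n : ℕ) : F :=
  if h : n < K - D then code K D x ⟨n, h⟩ else 0

/-- The message symbol `x_n`, the subscript being read modulo `K`. -/
def msg {F : Type*} {K : ℕ} [NeZero K] (x : Fin K → F) (n : ℕ) : F :=
  x (Fin.ofNat K n)

/-- The one-sided side-information `{x_{k+1}, …, x_{k+D}}` of the receiver `R_k`, as a set of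
indices modulo `K`. -/
def sideInfo (K D : ℕ) [NeZero K] (k : ℕ) : Set (Fin K) :=
  {j | ∃ d : ℕ, 1 ≤ d ∧ d ≤ D ∧ j = Fin.ofNat K (k + d)}

/-- `lam K D i` is `λ_i` (for `0 ≤ i ≤ l + 1`): `λ_0 = D`, `λ_1` is the remainder of `K - D` modulo
`λ_0`, and `λ_{i+2}` is the remainder of `λ_i` modulo `λ_{i+1}`. -/
def lam (K D : ℕ) : ℕ → ℕ
  | 0 => D
  | 1 => (K - D) % D
  | i + 2 => lam K D i % lam K D (i + 1)

/-- `lamPred K D i` is `λ_{i-1}`, with `λ_{-1} = K - D`. -/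
def lamPred (K D : ℕ) : ℕ → ℕ
  | 0 => K - D
  | i + 1 => lam K D i

/-- The quotients `β_i`: `λ_{i-1} = β_i λ_i + λ_{i+1}`. -/
def beta (K D i : ℕ) : ℕ := lamPred K D i / lam K D i

/-- The length `l` of the chain of divisions: the index with `λ_{l+1} = 0` and
`λ_0, …, λ_l` positive. -/
noncomputable def len (K D : ℕ) : ℕ := sInf {l | lam K D (l + 1) = 0}

/-- `⌈l / 2⌉`. -/
noncomputable def ceilHalf (K D : ℕ) : ℕ := (len K D + 1) / 2

/-- The interval `D_i`, an interval of integers intersected with `ℕ`. -/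
def setD (K D i : ℕ) : Set ℕ :=
  {k | (K : ℤ) - D - lamPred K D (2 * i) ≤ k ∧
    (k : ℤ) ≤ (K : ℤ) - D - lamPred K D (2 * i) + ((beta K D (2 * i) : ℤ) - 1) * lam K D (2 * i) - 1}

/-- The interval `E_i`, an interval of integers intersected with `ℕ`
(so that `E_0` is empty when `β_0 = 0`). -/
def setE (K D i : ℕ) : Set ℕ :=
  {k | (K : ℤ) - D - lamPred K D (2 * i) + ((beta K D (2 * i) : ℤ) - 1) * lam K D (2 * i) ≤ k ∧
    (k : ℤ) ≤ (K : ℤ) - D - lam K D (2 * i + 1) - 1}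

/-- The down-distance `d_down(k)`: `k' - k`, where `k'` is the largest row below row `k` with
`L(k', k) = 1` (the value is `0` if and only if there is no such row). -/
noncomputable def dDown (K D k : ℕ) : ℕ :=
  sSup {k' | k < k' ∧ k' < K ∧ entry K (K - D) k' k = 1} - k

/-- The right-distance `d_right(j, k)`: `k' - k`, where `k'` is the smallest column to the right of
column `k` with `L(j, k') = 1` (the value is `0` if and only if there is no such column). -/
noncomputable def dRight (K D j k : ℕ) : ℕ :=
  sInf {k' | k < k' ∧ k' < K - D ∧ entry K (K - D) j k' = 1} - k

/-- `μ_k = d_right(k + d_down(k), k)`. -/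
noncomputable def mu (K D k : ℕ) : ℕ := dRight K D (k + dDown K D k) k

/-- The set of the distances from `L(k + d_down(k), k + μ_k)` to the `1`s below it in its column. -/
noncomputable def downSet (K D k : ℕ) : Finset ℕ :=
  (Finset.range K).filter fun t => 0 < t ∧ k + dDown K D k + t < K ∧
    entry K (K - D) (k + dDown K D k + t) (k + mu K D k) = 1

/-- `p_k`, the number of `1`s below `L(k + d_down(k), k + μ_k)` in its column. -/
noncomputable def p (K D k : ℕ) : ℕ := (downSet K D k).card

/-- The down-distances `t_{k,1} < … < t_{k,p_k}`; `t K D k r` is `t_{k,r+1}`,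
for `r = 0, …, p_k - 1`. -/
noncomputable def t (K D k : ℕ) (r : Fin (p K D k)) : ℕ := (downSet K D k).orderEmbOfFin rfl r

/-- `∑_{z=1}^{i} ∑_{j=1}^{β_{2z-1}} x_{n + D - λ_{2z-2} + j λ_{2z-1}}`. -/
def nu {F : Type*} [Field F] (K D : ℕ) [NeZero K] (i n : ℕ) (x : Fin K → F) : F :=
  ∑ z ∈ Finset.Icc 1 i, ∑ j ∈ Finset.Icc 1 (beta K D (2 * z - 1)),
    msg x (n + D - lam K D (2 * z - 2) + j * lam K D (2 * z - 1))

/-- `x_n + ∑_{z=1}^{i} ∑_{j=1}^{β_{2z-1}} x_{n + D - λ_{2z-2} + j λ_{2z-1}}`. -/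
def nuSelf {F : Type*} [Field F] (K D : ℕ) [NeZero K] (i n : ℕ) (x : Fin K → F) : F :=
  msg x n + nu K D i n x

/-- `nuSelf` at `n`, plus `∑_{j=1}^{c} x_{n + D - λ_{2i} + j λ_{2i+1}}`. -/
def nuSelfTail {F : Type*} [Field F] (K D : ℕ) [NeZero K] (i c n : ℕ) (x : Fin K → F) : F :=
  nuSelf K D i n x +
    ∑ j ∈ Finset.Icc 1 c, msg x (n + D - lam K D (2 * i) + j * lam K D (2 * i + 1))

/-- The side-information term of a receiver `R_k`, `K - D - λ_l ≤ k ≤ K - D - 1`. -/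
noncomputable def nuLast {F : Type*} [Field F] (K D : ℕ) [NeZero K] (k : ℕ) (x : Fin K → F) : F :=
  if Odd (len K D) then nu K D (ceilHalf K D) k x
  else msg x (k + D) + nu K D (ceilHalf K D) k x

/-- The sum of all the message symbols present in the broadcast symbol `c_n`, except `x_k`. -/
def nuRest {F : Type*} [Field F] (K D : ℕ) (n k : ℕ) (x : Fin K → F) : F :=
  ∑ j ∈ Finset.univ.filter (fun j : Fin K => entry K (K - D) j n = 1 ∧ (j : ℕ) ≠ k), x j

end AIR

open AIR

/-!
Write `N = K - D`. Apart from the identity matrix on top, the AIR matrix is a nested sequence of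
corner blocks: its last `λ_{2i}` rows and last `λ_{2i-1}` columns consist of `β_{2i}` adjacent
identity matrices of size `λ_{2i}`, followed by a block of width `λ_{2i+1}`, which consists of
`β_{2i+1}` stacked identity matrices of size `λ_{2i+1}` above the next corner block (`entry_tail`,
`entry_block`). This holds whatever the order of `D` and `N`, with `β_0 = 0` if `N < D`.

Reading columns, a broadcast symbol `c_n` with `n ≥ N - λ_{2i-1}` is `x_n + S_i(n)` plus the part of
its column in the `i`-th corner block (`sym_eq_tail`). For `n` in the adjacent identity matrices of
level `i` that part is a single message symbol (`sym_eq_tail_left`). The receivers fall into the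
four cases according to the level of their column.

* For `k ∈ D_i` the columns `k` and `k + λ_{2i}` meet the same row of adjacent identity matrices, so
  the single symbols cancel in `c_k - c_{k + μ_k}`.
* For `k ∈ E_i` the column `k` lies in the last of these identity matrices, and the row of its
  single symbol has its next `1` in the block of width `λ_{2i+1}`. That `1` splits the column
  `k + μ_k` into `c` stacked symbols above it, the symbol itself, and the symbols below it
  (`sym_eq_nuSelfTail_add_sum`). A symbol at distance `t` below is the single symbol of `c_{k + t}`
  (`sym_last`), so adding the `c_{k + t}` removes it.
* For `N - λ_l ≤ k < N` the chain of divisions has ended, and the corner block contributes `x_{k+D}`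
  or nothing, according to the parity of `l` (`sym_eq_nuLast`).
* For `k ≥ N` the `1`s above row `k` in column `k % N` stand in rows congruent to `k` modulo `N`
  (`entry_column_mod`), so that all the other symbols of `c_{k % N}` are known to the receiver.

That the remaining terms are side-information comes down to the identity
`β_{2z-1} λ_{2z-1} = λ_{2z-2} - λ_{2z}`, which bounds the indices in `S_i(n)` by
`n + D - λ_{2i}` (`dependsOn_nu`).
-/

namespace AIR

/-! ### The entries of an AIR block -/

theorem entry_eq_zero_or_one (m n i j : ℕ) : entry m n i j = 0 ∨ entry m n i j = 1 := by
  fun_induction entry m n i j <;> simp_all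

/-- Peeling the stacked identity matrices off the top of a block. Nothing is assumed about the
order of `m` and `n`, so that this alternates with `entry_horizontal`. -/
theorem entry_vertical {m n i j : ℕ} (hi : i < m) (hj : j < n) :
    entry m n i j = if i < m / n * n then (if i % n = j then 1 else 0)
      else entry (m % n) n (i - m / n * n) j := by
  have hn : n ≠ 0 := by omega
  have hlt : m % n < n := Nat.mod_lt _ (by omega)
  split_ifs with h1 h2
  · rw [entry, dif_neg hn, if_pos h1, if_pos h2]
  · rw [entry, dif_neg hn, if_pos h1, if_neg h2]
  · have hr : m % n ≠ 0 := by
      have := Nat.div_add_mod' m n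
      omega
    rw [entry, dif_neg hn, if_neg h1, dif_neg hr, entry.eq_def (m % n) n (i - m / n * n) j,
      dif_neg hn, Nat.div_eq_of_lt hlt, Nat.mod_eq_of_lt hlt]
    simp [hr]

/-- Peeling the adjacent identity matrices off the left of a block. -/
theorem entry_horizontal {m n i j : ℕ} (hi : i < m) (hj : j < n) :
    entry m n i j = if j < n / m * m then (if j % m = i then 1 else 0)
      else entry m (n % m) i (j - n / m * m) := by
  have hn : n ≠ 0 := by omega
  have hm : m ≠ 0 := by omega
  rcases lt_trichotomy n m with h | rfl | h
  · simp [Nat.div_eq_of_lt h, Nat.mod_eq_of_lt h]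
  · rw [entry, dif_neg hn, Nat.div_self (by omega)]
    simp [hi, hj, Nat.mod_eq_of_lt, eq_comm]
  · rw [entry, dif_neg hn, Nat.div_eq_of_lt h, Nat.mod_eq_of_lt h]
    simp [hm]

/-- Below its topmost identity matrix, a block with at least as many rows as columns is again an
AIR block. -/
theorem entry_add_self {m n i j : ℕ} (hi : i < m) (hj : j < n) :
    entry (n + m) n (n + i) j = entry m n i j := by
  have hn : 0 < n := by omega
  rw [entry_vertical (by omega) hj, entry_vertical hi hj, Nat.add_div_left _ hn,
    Nat.add_mod_left, Nat.add_mod_left, Nat.succ_mul]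
  have : n + i < m / n * n + n ↔ i < m / n * n := by omega
  have h2 : n + i - (m / n * n + n) = i - m / n * n := by omega
  simp only [this, h2]

/-- In column `a % n`, the rows up to `a` carry a `1` exactly when they are congruent to `a`. If `a`
lies below the stacked identity matrices of size `n`, then row `a` meets column `a % n` in the first
of the adjacent identity matrices of size `m % n`, on its diagonal. -/
theorem entry_column_mod {m n a r : ℕ} (hn : 0 < n) (ha : a < m) (hr : r ≤ a) :
    entry m n r (a % n) = if r % n = a % n then 1 else 0 := by
  have hd := Nat.mod_lt a hn
  rw [entry_vertical (by omega) hd]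
  split_ifs with h1 h2 h2
  · rfl
  · rfl
  all_goals
    have hm := Nat.div_add_mod' m n
    have hmn := Nat.mod_lt m hn
    have hmod : ∀ s, m / n * n ≤ s → s < m → s % n = s - m / n * n := fun s h h' => by
      conv_lhs => rw [← Nat.sub_add_cancel h]
      rw [Nat.add_mul_mod_self_right, Nat.mod_eq_of_lt (by omega)]
    have e1 := hmod r (by omega) (by omega)
    have e2 := hmod a (by omega) ha
    have hlt : a % n < n / (m % n) * (m % n) :=
      lt_of_lt_of_le (by omega : a % n < m % n)
        (Nat.le_mul_of_pos_left _ (Nat.div_pos hmn.le (by omega)))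
    rw [entry_horizontal (by omega) hd, if_pos hlt, Nat.mod_eq_of_lt (by omega : a % n < m % n)]
    first
      | rw [if_pos (by omega)]
      | rw [if_neg (by omega)]

/-- The leftmost `1` of row `a` stands in column `a % n`. -/
theorem entry_row_mod {m n a j : ℕ} (hn : 0 < n) (ha : a < m) (hj : j ≤ a % n) :
    entry m n a j = if j = a % n then 1 else 0 := by
  have hd := Nat.mod_lt a hn
  rw [entry_vertical ha (by omega)]
  split_ifs with h1 h2 h2 h2
  · rfl
  · omega
  · omega
  · rfl
  all_goals
    have hm := Nat.div_add_mod' m n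
    have hmn := Nat.mod_lt m hn
    have e2 : a % n = a - m / n * n := by
      conv_lhs => rw [← Nat.sub_add_cancel (not_lt.mp h1)]
      rw [Nat.add_mul_mod_self_right, Nat.mod_eq_of_lt (by omega)]
    have hlt : j < n / (m % n) * (m % n) :=
      lt_of_lt_of_le (by omega : j < m % n)
        (Nat.le_mul_of_pos_left _ (Nat.div_pos hmn.le (by omega)))
    rw [entry_horizontal (by omega) (by omega), if_pos hlt,
      Nat.mod_eq_of_lt (by omega : j < m % n)]
    first
      | rw [if_pos (by omega)]
      | rw [if_neg (by omega)]

/-! ### Column sums of an AIR block -/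

section ColumnSums

variable {F : Type*} [Field F]

/-- A sum over the rows congruent to `d`; the last, incomplete period of `e ≤ d` rows
contributes nothing. -/
theorem sum_range_ite_mod {n d e : ℕ} (hd : d < n) (he : e ≤ d) (q : ℕ) (f : ℕ → F) :
    ∑ r ∈ Finset.range (q * n + e), (if r % n = d then f r else 0) =
      ∑ s ∈ Finset.range q, f (s * n + d) := by
  induction q with
  | zero =>
    refine Finset.sum_eq_zero fun r hr => ?_
    rw [Finset.mem_range] at hr
    rw [Nat.mod_eq_of_lt (by omega), if_neg (by omega)]
  | succ q ih =>
    rw [show (q + 1) * n + e = q * n + e + n by ring, Finset.sum_range_add, ih,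
      Finset.sum_range_succ]
    congr 1
    rw [Finset.sum_eq_single_of_mem (d - e) (Finset.mem_range.mpr (by omega))]
    · have : q * n + e + (d - e) = q * n + d := by omega
      rw [this, Nat.mul_add_mod', Nat.mod_eq_of_lt hd, if_pos rfl]
    · intro x hx hne
      rw [Finset.mem_range] at hx
      rw [add_assoc, Nat.mul_add_mod', if_neg]
      rcases lt_or_ge (e + x) n with h | h
      · rw [Nat.mod_eq_of_lt h]
        omega
      · rw [Nat.mod_eq_sub_mod h, Nat.mod_eq_of_lt (by omega)]
        omega

/-- The column sums of `entry_vertical`. -/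
theorem sum_entry_vertical {m n j : ℕ} (hj : j < n) (f : ℕ → F) :
    ∑ r ∈ Finset.range m, (entry m n r j : F) * f r =
      (∑ s ∈ Finset.range (m / n), f (s * n + j)) +
        ∑ r ∈ Finset.range (m % n), (entry (m % n) n r j : F) * f (m / n * n + r) := by
  have hm := Nat.div_add_mod' m n
  conv_lhs => rw [← hm, Finset.sum_range_add, hm]
  congr 1
  · rw [← sum_range_ite_mod hj (Nat.zero_le _)]
    refine Finset.sum_congr rfl fun r hr => ?_
    rw [Finset.mem_range, add_zero] at hr
    rw [entry_vertical (by omega) hj, if_pos hr]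
    split_ifs <;> simp
  · refine Finset.sum_congr rfl fun r hr => ?_
    rw [Finset.mem_range] at hr
    rw [entry_vertical (by omega) hj, if_neg (by omega), Nat.add_sub_cancel_left]

/-- The column sums of `entry_horizontal`, in a column of one of the identity matrices. -/
theorem sum_entry_horizontal_left {m n j : ℕ} (hm : 0 < m) (hj : j < n / m * m) (f : ℕ → F) :
    ∑ r ∈ Finset.range m, (entry m n r j : F) * f r = f (j % m) := by
  have hn := Nat.div_mul_le_self n m
  rw [Finset.sum_eq_single_of_mem (j % m) (Finset.mem_range.mpr (Nat.mod_lt _ hm))]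
  · rw [entry_horizontal (Nat.mod_lt _ hm) (by omega), if_pos hj]
    simp
  · intro r hr hne
    rw [Finset.mem_range] at hr
    rw [entry_horizontal hr (by omega), if_pos hj, if_neg (Ne.symm hne)]
    simp

/-- The column sums of `entry_horizontal`, to the right of the identity matrices. -/
theorem sum_entry_horizontal_right {m n j : ℕ} (hj : j < n % m) (f : ℕ → F) :
    ∑ r ∈ Finset.range m, (entry m n r (n / m * m + j) : F) * f r =
      ∑ r ∈ Finset.range m, (entry m (n % m) r j : F) * f r := by
  have hn := Nat.div_add_mod' n m
  refine Finset.sum_congr rfl fun r hr => ?_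
  rw [Finset.mem_range] at hr
  rw [entry_horizontal hr (by omega), if_neg (by omega), Nat.add_sub_cancel_left]

/-- The column sum of column `a % n`, split at row `a`. -/
theorem sum_entry_column_mod {m n a : ℕ} (hn : 0 < n) (ha : a < m) (f : ℕ → F) :
    ∑ r ∈ Finset.range m, (entry m n r (a % n) : F) * f r =
      (∑ s ∈ Finset.range (a / n), f (s * n + a % n)) + f a +
        ∑ r ∈ Finset.range m with a < r ∧ entry m n r (a % n) = 1, f r := by
  have hd := Nat.mod_lt a hn
  obtain ⟨e, rfl⟩ : ∃ e, m = a + 1 + e := ⟨m - (a + 1), by omega⟩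
  have hfil : (Finset.range (a + 1 + e)).filter
        (fun r => a < r ∧ entry (a + 1 + e) n r (a % n) = 1) =
      ((Finset.range e).filter
        (fun r => entry (a + 1 + e) n (a + 1 + r) (a % n) = 1)).map
        (addLeftEmbedding (a + 1)) := by
    ext r
    simp only [Finset.mem_filter, Finset.mem_range, Finset.mem_map, addLeftEmbedding_apply]
    constructor
    · rintro ⟨h1, h2, h3⟩
      have h4 : a + 1 + (r - (a + 1)) = r := by omega
      exact ⟨r - (a + 1), ⟨by omega, by rw [h4]; exact h3⟩, h4⟩
    · rintro ⟨s, ⟨h1, h2⟩, rfl⟩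
      exact ⟨by omega, by omega, h2⟩
  rw [hfil, Finset.sum_map, Finset.sum_filter, Finset.sum_range_add, Finset.sum_range_succ]
  congr 1
  · congr 1
    · rw [← sum_range_ite_mod hd le_rfl, Nat.div_add_mod']
      refine Finset.sum_congr rfl fun r hr => ?_
      rw [Finset.mem_range] at hr
      rw [entry_column_mod hn ha hr.le]
      split_ifs <;> simp
    · rw [entry_column_mod hn ha le_rfl]
      simp
  · refine Finset.sum_congr rfl fun r _ => ?_
    rcases entry_eq_zero_or_one (a + 1 + e) n (a + 1 + r) (a % n) with h | h <;> simp [h]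

end ColumnSums

/-! ### The chain of divisions -/

section Chain

variable {K D : ℕ}

theorem lam_succ (K D i : ℕ) : lam K D (i + 1) = lamPred K D i % lam K D i := by
  cases i <;> rfl

theorem lamPred_eq (K D i : ℕ) :
    lamPred K D i = beta K D i * lam K D i + lam K D (i + 1) := by
  rw [lam_succ, beta, Nat.div_add_mod']

theorem lam_succ_lt {i : ℕ} (h : 0 < lam K D i) : lam K D (i + 1) < lam K D i := by
  rw [lam_succ]
  exact Nat.mod_lt _ h

theorem lam_len (K D : ℕ) : lam K D (len K D + 1) = 0 := by
  have hne : {l | lam K D (l + 1) = 0}.Nonempty := by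
    by_contra hcon
    have hpos : ∀ l, 0 < lam K D (l + 1) := fun l =>
      Nat.pos_of_ne_zero fun h => hcon ⟨l, h⟩
    have hdesc : ∀ l, lam K D (l + 1) + l ≤ lam K D 1 := fun l => by
      induction l with
      | zero => simp
      | succ l ih =>
        have := lam_succ_lt (hpos l)
        omega
    have h1 := hdesc (lam K D 1)
    have h2 := hpos (lam K D 1)
    omega
  exact Nat.sInf_mem hne

theorem lam_pos (hD : 1 ≤ D) {i : ℕ} (hi : i ≤ len K D) : 0 < lam K D i := by
  cases i with
  | zero => exact hD
  | succ j => exact Nat.pos_of_ne_zero (Nat.notMem_of_lt_sInf (s := {l | lam K D (l + 1) = 0}) hi)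

theorem lam_anti (hD : 1 ≤ D) {i j : ℕ} (hij : i ≤ j) (hj : j ≤ len K D + 1) :
    lam K D j ≤ lam K D i := by
  induction j, hij using Nat.le_induction with
  | base => exact le_rfl
  | succ j _ ih =>
    exact (lam_succ_lt (lam_pos hD (by omega))).le.trans (ih (by omega))

theorem lam_le (hD : 1 ≤ D) {i : ℕ} (hi : i ≤ len K D + 1) : lam K D i ≤ D :=
  lam_anti hD (Nat.zero_le i) hi

/-- The widths `λ_{2i-1}` are bounded by the number of columns. For odd indices this fails, as
`λ_0 = D` may exceed `K - D`. -/
theorem lamPred_two_mul_le (hD : 1 ≤ D) {i : ℕ} (hi : 2 * i ≤ len K D + 1) :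
    lamPred K D (2 * i) ≤ K - D := by
  cases i with
  | zero => exact le_rfl
  | succ i =>
    exact (lam_anti hD (by omega : 1 ≤ 2 * i + 1) (by omega)).trans (Nat.mod_le _ _)

end Chain

/-! ### The nested blocks of the AIR matrix -/

section Blocks

variable {K D : ℕ}

theorem entry_top (hDK : D < K) {r n : ℕ} (hr : r < K - D) (hn : n < K - D) :
    entry K (K - D) r n = if r = n then 1 else 0 := by
  have h : K - D ≤ K / (K - D) * (K - D) :=
    Nat.le_mul_of_pos_left _ (Nat.div_pos (Nat.sub_le _ _) (by omega))
  rw [entry_vertical (by omega) hn, if_pos (by omega), Nat.mod_eq_of_lt hr]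

/-- The inductive step from `entry_tail` to `entry_block`, both being needed in turn. -/
theorem entry_block_of_entry_tail (hD : 1 ≤ D) {i : ℕ} (hi : 2 * i ≤ len K D + 1)
    (htail : ∀ {r n : ℕ}, r < lam K D (2 * i) → n < lamPred K D (2 * i) →
      entry K (K - D) (K - lam K D (2 * i) + r) (K - D - lamPred K D (2 * i) + n) =
        entry (lam K D (2 * i)) (lamPred K D (2 * i)) r n)
    {r n : ℕ} (hr : r < lam K D (2 * i)) (hn : n < lam K D (2 * i + 1)) :
    entry K (K - D) (K - lam K D (2 * i) + r) (K - D - lam K D (2 * i + 1) + n) =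
      entry (lam K D (2 * i)) (lam K D (2 * i + 1)) r n := by
  have h1 := lamPred_eq K D (2 * i)
  have h2 := lamPred_two_mul_le (K := K) hD hi
  have h3 : K - D - lam K D (2 * i + 1) + n =
      K - D - lamPred K D (2 * i) + (beta K D (2 * i) * lam K D (2 * i) + n) := by omega
  rw [h3, htail hr (by omega), entry_horizontal hr (by omega), ← beta, ← lam_succ,
    if_neg (by omega), Nat.add_sub_cancel_left]

/-- The last `λ_{2i}` rows and last `λ_{2i-1}` columns of the AIR matrix again form a block filled
by the recursive rule. Hypotheses of the form `2 * i ≤ len K D + 1` keep to the part of the chain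
where it decreases: after its first zero the sequence `lam` carries no meaning. -/
theorem entry_tail (hD : 1 ≤ D) (hDK : D < K) {i : ℕ} (hi : 2 * i ≤ len K D + 1) {r n : ℕ}
    (hr : r < lam K D (2 * i)) (hn : n < lamPred K D (2 * i)) :
    entry K (K - D) (K - lam K D (2 * i) + r) (K - D - lamPred K D (2 * i) + n) =
      entry (lam K D (2 * i)) (lamPred K D (2 * i)) r n := by
  induction i generalizing r n with
  | zero =>
    have h := entry_add_self (m := D) (n := K - D) hr hn
    rw [Nat.sub_add_cancel hDK.le] at h
    change entry K (K - D) (K - D + r) (K - D - (K - D) + n) = _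
    rw [Nat.sub_self, zero_add]
    exact h
  | succ i ih =>
    change r < lam K D (2 * i + 2) at hr
    change n < lam K D (2 * i + 1) at hn
    change entry K (K - D) (K - lam K D (2 * i + 2) + r) (K - D - lam K D (2 * i + 1) + n) =
      entry (lam K D (2 * i + 2)) (lam K D (2 * i + 1)) r n
    have h1 := lamPred_eq K D (2 * i + 1)
    change lam K D (2 * i) = _ + lam K D (2 * i + 2) at h1
    have h2 := lam_le (K := K) hD (i := 2 * i) (by omega)
    have h3 : K - lam K D (2 * i + 2) + r =
      K - lam K D (2 * i) + (beta K D (2 * i + 1) * lam K D (2 * i + 1) + r) := by omega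
    have hb : lam K D (2 * i) / lam K D (2 * i + 1) = beta K D (2 * i + 1) := rfl
    have hm : lam K D (2 * i) % lam K D (2 * i + 1) = lam K D (2 * i + 2) := rfl
    rw [h3, entry_block_of_entry_tail hD (by omega) (ih (by omega)) (by omega) hn,
      entry_vertical (by omega) hn, hb, hm, if_neg (by omega), Nat.add_sub_cancel_left]

/-- The last `λ_{2i}` rows and last `λ_{2i+1}` columns of the AIR matrix form a block filled by
the recursive rule: `entry_tail` without its identity matrices of size `λ_{2i}`. -/
theorem entry_block (hD : 1 ≤ D) (hDK : D < K) {i : ℕ} (hi : 2 * i ≤ len K D + 1) {r n : ℕ}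
    (hr : r < lam K D (2 * i)) (hn : n < lam K D (2 * i + 1)) :
    entry K (K - D) (K - lam K D (2 * i) + r) (K - D - lam K D (2 * i + 1) + n) =
      entry (lam K D (2 * i)) (lam K D (2 * i + 1)) r n :=
  entry_block_of_entry_tail hD hi (entry_tail hD hDK hi) hr hn

/-- The columns `K - D - λ_{2i-1}, …, K - D - λ_{2i+1} - 1` carry identity matrices of size
`λ_{2i}` in the last `λ_{2i}` rows. -/
theorem entry_tail_left (hD : 1 ≤ D) (hDK : D < K) {i : ℕ} (hi : 2 * i ≤ len K D + 1) {r b : ℕ}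
    (hr : r < lam K D (2 * i)) (hb : b < beta K D (2 * i) * lam K D (2 * i)) :
    entry K (K - D) (K - lam K D (2 * i) + r) (K - D - lamPred K D (2 * i) + b) =
      if b % lam K D (2 * i) = r then 1 else 0 := by
  have h1 := lamPred_eq K D (2 * i)
  rw [entry_tail hD hDK hi hr (by omega), entry_horizontal hr (by omega), ← beta, if_pos hb]

end Blocks

/-! ### The broadcast symbols -/

section Symbols

variable {F : Type*} [Field F] {K D : ℕ} [NeZero K]

theorem sym_eq_sum (x : Fin K → F) {n : ℕ} (hn : n < K - D) :
    sym K D x n = ∑ r ∈ Finset.range K, (entry K (K - D) r n : F) * msg x r := by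
  rw [sym, dif_pos hn, code, Matrix.vecMul, dotProduct, Finset.sum_range]
  refine Finset.sum_congr rfl fun r _ => ?_
  rw [airMatrix, Matrix.of_apply, mul_comm, msg, Fin.ofNat_val_eq_self]

theorem nu_succ (i n : ℕ) (x : Fin K → F) :
    nu K D (i + 1) n x = nu K D i n x +
      ∑ j ∈ Finset.Icc 1 (beta K D (2 * i + 1)),
        msg x (n + D - lam K D (2 * i) + j * lam K D (2 * i + 1)) := by
  rw [nu, Finset.sum_Icc_succ_top (by omega)]
  rfl

/-- Reindexing of the sum over the stacked identity matrices of size `λ_{2i+1}`. -/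
theorem sum_range_msg_stack (hD : 1 ≤ D) (hDK : D < K) {i : ℕ} (hi : 2 * i + 1 ≤ len K D + 1)
    {d : ℕ} (c : ℕ) (x : Fin K → F) :
    ∑ s ∈ Finset.range c, msg x (K - lam K D (2 * i) + (s * lam K D (2 * i + 1) + d)) =
      ∑ j ∈ Finset.Icc 1 c, msg x
        (K - D - lam K D (2 * i + 1) + d + D - lam K D (2 * i) + j * lam K D (2 * i + 1)) := by
  have h2 := lam_le (K := K) hD (i := 2 * i) (by omega)
  have h3 : lam K D (2 * i + 1) ≤ K - D :=
    (lam_anti hD (by omega : 1 ≤ 2 * i + 1) hi).trans (Nat.mod_le _ _)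
  rw [Finset.range_eq_Ico]
  refine Eq.trans (Finset.sum_congr rfl fun s _ => ?_) (Finset.sum_Ico_add' (fun j => msg x
    (K - D - lam K D (2 * i + 1) + d + D - lam K D (2 * i) + j * lam K D (2 * i + 1))) 0 c 1)
  congr 1
  rw [Nat.succ_mul s]
  omega

/-- A broadcast symbol, up to the part of its column in the corner block `entry_tail`. -/
theorem sym_eq_tail (hD : 1 ≤ D) (hDK : D < K) {i : ℕ} (hi : 2 * i ≤ len K D + 1) {n : ℕ}
    (hn : n < lamPred K D (2 * i)) (x : Fin K → F) :
    sym K D x (K - D - lamPred K D (2 * i) + n) =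
      nuSelf K D i (K - D - lamPred K D (2 * i) + n) x +
        ∑ r ∈ Finset.range (lam K D (2 * i)),
          (entry (lam K D (2 * i)) (lamPred K D (2 * i)) r n : F) *
            msg x (K - lam K D (2 * i) + r) := by
  induction i generalizing n with
  | zero =>
    change n < K - D at hn
    change sym K D x (K - D - (K - D) + n) = nuSelf K D 0 (K - D - (K - D) + n) x +
      ∑ r ∈ Finset.range D, (entry D (K - D) r n : F) * msg x (K - D + r)
    rw [Nat.sub_self, zero_add, sym_eq_sum x hn]
    have hK : Finset.range K = Finset.range (K - D + D) := by rw [Nat.sub_add_cancel hDK.le]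
    rw [hK, Finset.sum_range_add]
    congr 1
    · rw [Finset.sum_eq_single_of_mem n (Finset.mem_range.mpr hn), entry_top hDK hn hn]
      · simp [nuSelf, nu]
      · intro r hr hne
        rw [entry_top hDK (Finset.mem_range.mp hr) hn, if_neg hne]
        simp
    · refine Finset.sum_congr rfl fun r hr => ?_
      have h := entry_add_self (Finset.mem_range.mp hr) hn
      rw [Nat.sub_add_cancel hDK.le] at h
      rw [h]
  | succ i ih =>
    change n < lam K D (2 * i + 1) at hn
    change sym K D x (K - D - lam K D (2 * i + 1) + n) =
      nuSelf K D (i + 1) (K - D - lam K D (2 * i + 1) + n) x +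
        ∑ r ∈ Finset.range (lam K D (2 * i + 2)),
          (entry (lam K D (2 * i + 2)) (lam K D (2 * i + 1)) r n : F) *
            msg x (K - lam K D (2 * i + 2) + r)
    have h1 := lamPred_eq K D (2 * i)
    have h2 := lamPred_two_mul_le (K := K) hD (i := i) (by omega)
    have h3 : K - D - lam K D (2 * i + 1) + n =
      K - D - lamPred K D (2 * i) + (beta K D (2 * i) * lam K D (2 * i) + n) := by omega
    have h4 := lamPred_eq K D (2 * i + 1)
    change lam K D (2 * i) = _ + lam K D (2 * i + 2) at h4
    have h5 := lam_le (K := K) hD (i := 2 * i) (by omega)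
    have hb : lam K D (2 * i) / lam K D (2 * i + 1) = beta K D (2 * i + 1) := rfl
    have hm : lam K D (2 * i) % lam K D (2 * i + 1) = lam K D (2 * i + 2) := rfl
    have ih' := ih (n := beta K D (2 * i) * lam K D (2 * i) + n) (by omega) (by omega)
    rw [← h3] at ih'
    rw [ih', beta, sum_entry_horizontal_right (lam_succ K D (2 * i) ▸ hn), ← lam_succ,
      sum_entry_vertical hn, hb, hm, sum_range_msg_stack hD hDK (by omega), nuSelf, nuSelf,
      nu_succ, ← add_assoc, ← add_assoc]
    congr 1
    refine Finset.sum_congr rfl fun r _ => ?_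
    congr 2
    omega

/-- A broadcast symbol, up to the part of its column in the corner block `entry_block`. -/
theorem sym_eq_block (hD : 1 ≤ D) (hDK : D < K) {i : ℕ} (hi : 2 * i ≤ len K D + 1) {n : ℕ}
    (hn : n < lam K D (2 * i + 1)) (x : Fin K → F) :
    sym K D x (K - D - lam K D (2 * i + 1) + n) =
      nuSelf K D i (K - D - lam K D (2 * i + 1) + n) x +
        ∑ r ∈ Finset.range (lam K D (2 * i)),
          (entry (lam K D (2 * i)) (lam K D (2 * i + 1)) r n : F) *
            msg x (K - lam K D (2 * i) + r) := by
  have h1 := lamPred_eq K D (2 * i)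
  have h2 := lamPred_two_mul_le (K := K) hD hi
  have h3 : K - D - lam K D (2 * i + 1) + n =
    K - D - lamPred K D (2 * i) + (beta K D (2 * i) * lam K D (2 * i) + n) := by omega
  rw [h3, sym_eq_tail hD hDK hi (by omega), beta,
    sum_entry_horizontal_right (lam_succ K D (2 * i) ▸ hn), ← lam_succ]

/-- In the columns of `entry_tail_left`, exactly one message symbol is missing from `nuSelf`. -/
theorem sym_eq_tail_left (hD : 1 ≤ D) (hDK : D < K) {i : ℕ} (hi : 2 * i ≤ len K D + 1) {b : ℕ}
    (hb : b < beta K D (2 * i) * lam K D (2 * i)) (x : Fin K → F) :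
    sym K D x (K - D - lamPred K D (2 * i) + b) =
      nuSelf K D i (K - D - lamPred K D (2 * i) + b) x +
        msg x (K - lam K D (2 * i) + b % lam K D (2 * i)) := by
  have h1 := lamPred_eq K D (2 * i)
  have hpos : 0 < lam K D (2 * i) := Nat.pos_of_ne_zero fun h => by simp [h] at hb
  rw [sym_eq_tail hD hDK hi (by omega), sum_entry_horizontal_left hpos hb]

end Symbols

/-! ### Side-information -/

theorem msg_eq_of_sideInfo {F : Type*} {K D : ℕ} [NeZero K] {k : ℕ}
    {x y : Fin K → F} (h : ∀ j ∈ sideInfo K D k, x j = y j) {n : ℕ} (h1 : k < n) (h2 : n ≤ k + D) :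
    msg x n = msg y n :=
  h _ ⟨n - k, by omega, by omega, by rw [Nat.add_sub_cancel' h1.le]⟩

section SideInformation

variable {F : Type*} [Field F] {K D : ℕ} [NeZero K]

/-- The bound `hc` says that the last index of the sum is at most `k + D`. -/
theorem sum_stack_eq_of_sideInfo (hD : 1 ≤ D) {i n k c : ℕ} (hi : 2 * i + 1 ≤ len K D)
    (hk : k ≤ n) (hc : n + c * lam K D (2 * i + 1) ≤ k + lam K D (2 * i)) {x y : Fin K → F}
    (h : ∀ j ∈ sideInfo K D k, x j = y j) :
    ∑ j ∈ Finset.Icc 1 c, msg x (n + D - lam K D (2 * i) + j * lam K D (2 * i + 1)) =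
      ∑ j ∈ Finset.Icc 1 c, msg y (n + D - lam K D (2 * i) + j * lam K D (2 * i + 1)) := by
  refine Finset.sum_congr rfl fun j hj => msg_eq_of_sideInfo h ?_ ?_
  all_goals
    rw [Finset.mem_Icc] at hj
    have h1 := Nat.mul_le_mul_right (lam K D (2 * i + 1)) hj.1
    have h2 := Nat.mul_le_mul_right (lam K D (2 * i + 1)) hj.2
    have h3 := lam_pos hD hi
    have h4 := lam_le (K := K) hD (i := 2 * i) (by omega)
    omega

theorem dependsOn_nu (hD : 1 ≤ D) {i n k : ℕ} (hi : 2 * i ≤ len K D + 1) (hk : k ≤ n)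
    (hn : n ≤ k + lam K D (2 * i)) :
    DependsOn (nu (F := F) K D i n) (sideInfo K D k) := by
  intro x y h
  induction i with
  | zero => simp [nu]
  | succ i ih =>
    change n ≤ k + lam K D (2 * i + 2) at hn
    have h1 := lamPred_eq K D (2 * i + 1)
    change lam K D (2 * i) = _ + lam K D (2 * i + 2) at h1
    rw [nu_succ, nu_succ, ih (by omega) (by omega),
      sum_stack_eq_of_sideInfo hD (by omega) hk (by omega) h]

theorem dependsOn_nuSelf (hD : 1 ≤ D) {i n k : ℕ} (hi : 2 * i ≤ len K D + 1) (hk : k < n)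
    (hn : n ≤ k + lam K D (2 * i)) :
    DependsOn (nuSelf (F := F) K D i n) (sideInfo K D k) := by
  intro x y h
  have h4 := lam_le (K := K) hD hi
  rw [nuSelf, nuSelf, dependsOn_nu hD hi hk.le hn h, msg_eq_of_sideInfo h hk (by omega)]

theorem dependsOn_nuSelfTail (hD : 1 ≤ D) {i n k c : ℕ} (hi : 2 * i + 1 ≤ len K D) (hk : k < n)
    (hc : n + c * lam K D (2 * i + 1) ≤ k + lam K D (2 * i)) :
    DependsOn (nuSelfTail (F := F) K D i c n) (sideInfo K D k) := by
  intro x y h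
  rw [nuSelfTail, nuSelfTail, dependsOn_nuSelf hD (by omega) hk (by omega) h,
    sum_stack_eq_of_sideInfo hD hi hk.le hc h]

end SideInformation

/-! ### Down-distances and right-distances -/

section Distances

variable {K D : ℕ}

theorem add_dDown_eq {k k' : ℕ} (hk : k < k') (hk' : k' < K) (h1 : entry K (K - D) k' k = 1)
    (hmax : ∀ r, k' < r → r < K → entry K (K - D) r k ≠ 1) : k + dDown K D k = k' := by
  have h : IsGreatest {q | k < q ∧ q < K ∧ entry K (K - D) q k = 1} k' :=
    ⟨⟨hk, hk', h1⟩, fun r hr => not_lt.mp fun hlt => hmax r hlt hr.2.1 hr.2.2⟩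
  rw [dDown, h.csSup_eq]
  omega

theorem add_dRight_eq {j k k' : ℕ} (hk : k < k') (hk' : k' < K - D)
    (h1 : entry K (K - D) j k' = 1)
    (hmin : ∀ q, k < q → q < k' → entry K (K - D) j q ≠ 1) : k + dRight K D j k = k' := by
  have h : IsLeast {q | k < q ∧ q < K - D ∧ entry K (K - D) j q = 1} k' :=
    ⟨⟨hk, hk', h1⟩, fun q hq => not_lt.mp fun hlt => hmin q hq.1 hlt hq.2.2⟩
  rw [dRight, h.csInf_eq]
  omega

theorem add_dDown_tail_left (hD : 1 ≤ D) (hDK : D < K) {i : ℕ} (hi : 2 * i ≤ len K D + 1)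
    {b : ℕ} (hb : b < beta K D (2 * i) * lam K D (2 * i)) :
    K - D - lamPred K D (2 * i) + b + dDown K D (K - D - lamPred K D (2 * i) + b) =
      K - lam K D (2 * i) + b % lam K D (2 * i) := by
  have hpos : 0 < lam K D (2 * i) := Nat.pos_of_ne_zero fun h => by simp [h] at hb
  have h1 := lamPred_eq K D (2 * i)
  have h2 := lamPred_two_mul_le (K := K) hD hi
  have h3 := lam_le (K := K) hD hi
  have h4 := Nat.mod_lt b hpos
  refine add_dDown_eq (by omega) (by omega) ?_ fun r hr hrK => ?_
  · rw [entry_tail_left hD hDK hi h4 hb, if_pos rfl]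
  · have h5 : r = K - lam K D (2 * i) + (r - (K - lam K D (2 * i))) := by omega
    rw [h5, entry_tail_left hD hDK hi (by omega) hb, if_neg (by omega)]
    exact zero_ne_one

/-- Before the last identity matrix of size `λ_{2i}`, the next `1` to the right of the lowest `1`
of a column is the corresponding entry of the next identity matrix. -/
theorem mu_of_lt (hD : 1 ≤ D) (hDK : D < K) {i : ℕ} (hi : 2 * i ≤ len K D + 1)
    {b : ℕ} (hb : b + lam K D (2 * i) < beta K D (2 * i) * lam K D (2 * i)) :
    mu K D (K - D - lamPred K D (2 * i) + b) = lam K D (2 * i) := by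
  have hpos : 0 < lam K D (2 * i) := Nat.pos_of_ne_zero fun h => by simp [h] at hb
  have h1 := lamPred_eq K D (2 * i)
  have h2 := lamPred_two_mul_le (K := K) hD hi
  have h4 := Nat.mod_lt b hpos
  refine Nat.add_left_cancel (n := K - D - lamPred K D (2 * i) + b) ?_
  rw [mu, add_dDown_tail_left hD hDK hi (by omega)]
  refine add_dRight_eq (by omega) (by omega) ?_ fun q hq hq' => ?_
  · rw [add_assoc, entry_tail_left hD hDK hi h4 hb, Nat.add_mod_right, if_pos rfl]
  · obtain ⟨e, rfl⟩ : ∃ e, q = K - D - lamPred K D (2 * i) + (b + e) :=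
      ⟨q - (K - D - lamPred K D (2 * i) + b), by omega⟩
    rw [entry_tail_left hD hDK hi h4 (by omega), if_neg]
    · exact zero_ne_one
    · intro h
      have h5 : e % lam K D (2 * i) = 0 :=
        (Nat.modEq_zero_iff_dvd.mp (Nat.ModEq.add_left_cancel' b h) |> Nat.mod_eq_zero_of_dvd)
      rw [Nat.mod_eq_of_lt (by omega)] at h5
      omega

/-- A column of the last identity matrix of size `λ_{2i}`, in the coordinates of
`entry_tail_left`. -/
theorem last_identity_column (hD : 1 ≤ D) {i : ℕ} (hi : 2 * i ≤ len K D + 1)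
    (hβ : 0 < beta K D (2 * i)) {a : ℕ} (ha : a < lam K D (2 * i)) :
    ∃ b, K - D - lam K D (2 * i + 1) - lam K D (2 * i) + a = K - D - lamPred K D (2 * i) + b ∧
      b < beta K D (2 * i) * lam K D (2 * i) ∧ b % lam K D (2 * i) = a ∧
      b + (lam K D (2 * i) - a) = beta K D (2 * i) * lam K D (2 * i) := by
  have h1 := lamPred_eq K D (2 * i)
  have h2 := lamPred_two_mul_le (K := K) hD hi
  obtain ⟨β, hβ'⟩ := Nat.exists_eq_add_of_lt hβ
  rw [hβ', zero_add, Nat.succ_mul β] at h1 ⊢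
  refine ⟨β * lam K D (2 * i) + a, by omega, by omega, ?_, by omega⟩
  rw [Nat.mul_add_mod', Nat.mod_eq_of_lt ha]

/-- From the last identity matrix of size `λ_{2i}`, the next `1` to the right of the lowest `1`
of a column is the first `1` of a row of the corner block `entry_block`. -/
theorem add_mu_last (hD : 1 ≤ D) (hDK : D < K) {i : ℕ} (hi : 2 * i + 1 ≤ len K D)
    (hβ : 0 < beta K D (2 * i)) {a : ℕ} (ha : a < lam K D (2 * i)) :
    K - D - lam K D (2 * i + 1) - lam K D (2 * i) + a +
        mu K D (K - D - lam K D (2 * i + 1) - lam K D (2 * i) + a) =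
      K - D - lam K D (2 * i + 1) + a % lam K D (2 * i + 1) := by
  obtain ⟨b, hk, hb, hba, hb'⟩ := last_identity_column (K := K) hD (by omega) hβ ha
  have hpos : 0 < lam K D (2 * i + 1) := lam_pos hD hi
  have h1 := lamPred_eq K D (2 * i)
  have h2 := lamPred_two_mul_le (K := K) (i := i) hD (by omega)
  have h4 := Nat.mod_lt a hpos
  rw [hk, mu, add_dDown_tail_left hD hDK (by omega) hb, hba]
  refine add_dRight_eq (by omega) (by omega) ?_ fun q hq hq' => ?_
  · rw [entry_block hD hDK (by omega) ha h4, entry_row_mod hpos ha le_rfl, if_pos rfl]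
  · rcases lt_or_ge q (K - D - lam K D (2 * i + 1)) with h | h
    · obtain ⟨e, rfl⟩ : ∃ e, q = K - D - lamPred K D (2 * i) + (b + e) :=
        ⟨q - (K - D - lamPred K D (2 * i) + b), by omega⟩
      have h5 : (b + e) % lam K D (2 * i) = a + e := by
        rw [← Nat.mod_add_mod, hba, Nat.mod_eq_of_lt (by omega)]
      rw [entry_tail_left hD hDK (by omega) ha (by omega), h5, if_neg (by omega)]
      exact zero_ne_one
    · obtain ⟨j, rfl⟩ := Nat.exists_eq_add_of_le h
      rw [entry_block hD hDK (by omega) ha (by omega), entry_row_mod hpos ha (by omega),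
        if_neg (by omega)]
      exact zero_ne_one

theorem t_mem_downSet (K D k : ℕ) (r : Fin (p K D k)) : t K D k r ∈ downSet K D k :=
  Finset.orderEmbOfFin_mem _ _ _

theorem sum_t {F : Type*} [Field F] (K D k : ℕ) (f : ℕ → F) :
    ∑ r, f (t K D k r) = ∑ s ∈ downSet K D k, f s := by
  rw [← Finset.sum_coe_sort (downSet K D k)]
  exact ((downSet K D k).orderIsoOfFin rfl).toEquiv.sum_comp fun s => f s

end Distances

/-! ### Decoding -/

section Decoding

variable {F : Type*} [Field F] {K D : ℕ}

theorem two_mul_le_of_le_ceilHalf {i : ℕ} (hi : i ≤ ceilHalf K D) : 2 * i ≤ len K D + 1 := by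
  rw [ceilHalf] at hi
  omega

theorem two_mul_lt_of_lt_ceilHalf {i : ℕ} (hi : i < ceilHalf K D) : 2 * i + 1 ≤ len K D := by
  rw [ceilHalf] at hi
  omega

/-- Only `β_0` can vanish, namely when `K - D < D`. -/
theorem beta_succ_pos (hD : 1 ≤ D) {i : ℕ} (hi : i + 1 ≤ len K D) : 0 < beta K D (i + 1) :=
  Nat.div_pos (lam_anti hD (Nat.le_succ i) (by omega)) (lam_pos hD hi)

/-- A receiver in `D_i`, in the coordinates of `entry_tail_left`. -/
theorem exists_of_mem_setD (hD : 1 ≤ D) {i k : ℕ} (hi : i ≤ ceilHalf K D)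
    (hk : k ∈ setD K D i) :
    ∃ b, k = K - D - lamPred K D (2 * i) + b ∧
      b + lam K D (2 * i) < beta K D (2 * i) * lam K D (2 * i) := by
  have h2 := lamPred_two_mul_le (K := K) hD (two_mul_le_of_le_ceilHalf hi)
  obtain ⟨h3, h4⟩ := hk
  rw [sub_one_mul, ← Nat.cast_mul] at h4
  exact ⟨k - (K - D - lamPred K D (2 * i)), by omega, by omega⟩

/-- A receiver in `E_i` belongs to a column of the last identity matrix of size `λ_{2i}`. -/
theorem exists_of_mem_setE (hD : 1 ≤ D) (hDK : D < K) {i k : ℕ} (hi : i < ceilHalf K D)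
    (hk : k ∈ setE K D i) :
    0 < beta K D (2 * i) ∧ ∃ a < lam K D (2 * i),
      k = K - D - lam K D (2 * i + 1) - lam K D (2 * i) + a := by
  have hi' := two_mul_lt_of_lt_ceilHalf hi
  have h1 := lamPred_eq K D (2 * i)
  have h2 := lamPred_two_mul_le (K := K) (i := i) hD (by omega)
  obtain ⟨h3, h4⟩ := hk
  have hβ : 0 < beta K D (2 * i) := by
    cases i with
    | zero =>
      -- `β_0 = 0` forces `λ_1 = K - D`, and then `E_0` is empty
      refine Nat.pos_of_ne_zero fun h => ?_
      rw [h, zero_mul] at h1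
      change K - D = _ at h1
      omega
    | succ i => exact beta_succ_pos hD (i := 2 * i + 1) (by omega)
  refine ⟨hβ, ?_⟩
  obtain ⟨β, hβ'⟩ := Nat.exists_eq_add_of_lt hβ
  rw [hβ', zero_add] at h3 h1
  rw [Nat.cast_succ, add_sub_cancel_right, ← Nat.cast_mul] at h3
  rw [Nat.succ_mul β] at h1
  exact ⟨k - (K - D - lam K D (2 * i + 1) - lam K D (2 * i)), by omega, by omega⟩

theorem cases_cover (hD : 1 ≤ D) (hDK : D < K) (k : ℕ) :
    (∃ i ≤ ceilHalf K D, k ∈ setD K D i) ∨ (∃ i < ceilHalf K D, k ∈ setE K D i) ∨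
      (K - D - lam K D (len K D) ≤ k ∧ k < K - D) ∨ K - D ≤ k := by
  rcases lt_or_ge k (K - D) with hkN | hkN
  swap
  · exact Or.inr (Or.inr (Or.inr hkN))
  -- `i` is the last level whose columns start at or before `k`
  have h0 : K - D - lamPred K D (2 * 0) ≤ k := by
    change K - D - (K - D) ≤ k
    omega
  obtain ⟨i, hi, hik, hmax⟩ : ∃ i ≤ ceilHalf K D, K - D - lamPred K D (2 * i) ≤ k ∧
      ∀ j ≤ ceilHalf K D, i < j → ¬ K - D - lamPred K D (2 * j) ≤ k := by
    classical
    refine ⟨Nat.findGreatest (fun i => K - D - lamPred K D (2 * i) ≤ k) (ceilHalf K D),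
      Nat.findGreatest_le _, ?_, fun j hj hij => Nat.findGreatest_is_greatest
        (P := fun i => K - D - lamPred K D (2 * i) ≤ k) hij hj⟩
    exact Nat.findGreatest_spec (P := fun i => K - D - lamPred K D (2 * i) ≤ k)
      (Nat.zero_le _) h0
  have h1 := lamPred_eq K D (2 * i)
  have h2 := lamPred_two_mul_le (K := K) hD (two_mul_le_of_le_ceilHalf hi)
  rcases lt_or_ge (k + lam K D (2 * i)) (K - D - lam K D (2 * i + 1)) with h | h
  · refine Or.inl ⟨i, hi, by omega, ?_⟩
    rw [sub_one_mul, ← Nat.cast_mul]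
    omega
  · rcases hi.lt_or_eq with hlt | rfl
    · have h3 : ¬ K - D - lam K D (2 * i + 1) ≤ k := hmax (i + 1) hlt (Nat.lt_succ_self i)
      refine Or.inr (Or.inl ⟨i, hlt, ?_, by omega⟩)
      rw [sub_one_mul, ← Nat.cast_mul]
      omega
    · refine Or.inr (Or.inr (Or.inl ⟨?_, hkN⟩))
      rcases Nat.even_or_odd' (len K D) with ⟨e, he | he⟩
      · have h4 : 2 * ceilHalf K D = len K D := by rw [ceilHalf]; omega
        rw [h4, lam_len] at h
        omega
      · have h4 : 2 * ceilHalf K D = len K D + 1 := by rw [ceilHalf]; omega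
        rw [h4] at hik
        exact hik

variable [NeZero K]

/-- The column `k + μ_k` of a receiver in `E_i`, split at the row `k + d_down(k)`. -/
theorem sym_eq_nuSelfTail_add_sum (hD : 1 ≤ D) (hDK : D < K) {i : ℕ} (hi : 2 * i + 1 ≤ len K D)
    (hβ : 0 < beta K D (2 * i)) {a k : ℕ} (ha : a < lam K D (2 * i))
    (hk : k = K - D - lam K D (2 * i + 1) - lam K D (2 * i) + a) (x : Fin K → F) :
    sym K D x (k + mu K D k) = nuSelfTail K D i (a / lam K D (2 * i + 1)) (k + mu K D k) x +
      msg x (k + dDown K D k) + ∑ s ∈ downSet K D k, msg x (k + dDown K D k + s) := by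
  have hpos : 0 < lam K D (2 * i + 1) := lam_pos hD hi
  have hd := Nat.mod_lt a hpos
  have hlam := lam_le (K := K) (i := 2 * i) hD (by omega)
  have hmu := add_mu_last hD hDK hi hβ ha
  have hdown : k + dDown K D k = K - lam K D (2 * i) + a := by
    obtain ⟨b, hkb, hb, hba, -⟩ := last_identity_column (K := K) hD (by omega) hβ ha
    rw [hk, hkb, add_dDown_tail_left hD hDK (by omega) hb, hba]
  rw [← hk] at hmu
  rw [hmu, sym_eq_block hD hDK (by omega) hd, sum_entry_column_mod hpos ha,
    sum_range_msg_stack hD hDK (by omega), nuSelfTail, hdown, ← add_assoc, ← add_assoc]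
  congr 1
  refine Finset.sum_nbij' (fun r => r - a) (fun s => a + s) ?_ ?_ ?_ ?_ ?_
  · intro r hr
    rw [Finset.mem_filter, Finset.mem_range] at hr
    obtain ⟨h1, h2, h3⟩ := hr
    have h4 : K - lam K D (2 * i) + a + (r - a) = K - lam K D (2 * i) + r := by omega
    rw [downSet, Finset.mem_filter, Finset.mem_range, hdown, hmu, h4,
      entry_block hD hDK (by omega) h1 hd]
    exact ⟨by omega, by omega, by omega, h3⟩
  · intro s hs
    rw [downSet, Finset.mem_filter, Finset.mem_range, hdown, hmu, add_assoc] at hs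
    obtain ⟨-, h1, h2, h3⟩ := hs
    have h4 : a + s < lam K D (2 * i) := by omega
    rw [entry_block hD hDK (by omega) h4 hd] at h3
    rw [Finset.mem_filter, Finset.mem_range]
    exact ⟨h4, by omega, h3⟩
  · intro r hr
    rw [Finset.mem_filter] at hr
    omega
  · intro s _
    exact Nat.add_sub_cancel_left a s
  · intro r hr
    rw [Finset.mem_filter] at hr
    congr 1
    omega

/-- Each message symbol below row `k + d_down(k)` is supplied by the broadcast symbol of a column of
the same identity matrix as column `k`, at the same distance to the right of it. -/
theorem sym_last (hD : 1 ≤ D) (hDK : D < K) {i : ℕ} (hi : 2 * i ≤ len K D + 1)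
    (hβ : 0 < beta K D (2 * i)) {a k s : ℕ} (ha : a < lam K D (2 * i))
    (hk : k = K - D - lam K D (2 * i + 1) - lam K D (2 * i) + a)
    (hs : k + dDown K D k + s < K) (x : Fin K → F) :
    a + s < lam K D (2 * i) ∧
    sym K D x (k + s) = nuSelf K D i (k + s) x + msg x (k + dDown K D k + s) := by
  have hlam := lam_le (K := K) hD hi
  have hdown : k + dDown K D k = K - lam K D (2 * i) + a := by
    obtain ⟨b, hkb, hb, hba, -⟩ := last_identity_column (K := K) hD hi hβ ha
    rw [hk, hkb, add_dDown_tail_left hD hDK hi hb, hba]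
  rw [hdown] at hs ⊢
  have has : a + s < lam K D (2 * i) := by omega
  obtain ⟨b, hkb, hb, hba, -⟩ := last_identity_column (K := K) hD hi hβ has
  rw [← add_assoc, ← hk] at hkb
  refine ⟨has, ?_⟩
  rw [hkb, sym_eq_tail_left hD hDK hi hb, hba, add_assoc]

theorem sym_eq_nuLast (hD : 1 ≤ D) (hDK : D < K) {k : ℕ} (h1 : K - D - lam K D (len K D) ≤ k)
    (h2 : k < K - D) (x : Fin K → F) : sym K D x k = msg x k + nuLast K D k x := by
  have h0 := lam_len K D
  rcases Nat.even_or_odd' (len K D) with ⟨e, he | he⟩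
  · have hodd : ¬ Odd (len K D) := Nat.not_odd_iff_even.mpr ⟨e, by omega⟩
    have hc : ceilHalf K D = e := by rw [ceilHalf]; omega
    rw [nuLast, if_neg hodd, hc]
    rw [he] at h0 h1
    have h3 := lamPred_eq K D (2 * e)
    have h4 := lamPred_two_mul_le (K := K) (i := e) hD (by omega)
    have hlam := lam_le (K := K) (i := 2 * e) hD (by omega)
    -- `λ_{l-1} = β_l λ_l` as `λ_{l+1} = 0`
    have hβ : 0 < beta K D (2 * e) := by
      refine Nat.pos_of_ne_zero fun h => ?_
      rw [h, zero_mul, h0] at h3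
      cases e with
      | zero =>
        change K - D = _ at h3
        omega
      | succ e => exact (lam_pos (K := K) (i := 2 * e + 1) hD (by omega)).ne' h3
    have hle : lam K D (2 * e) ≤ beta K D (2 * e) * lam K D (2 * e) :=
      Nat.le_mul_of_pos_left _ hβ
    obtain ⟨b, hkb, hb, hba, -⟩ := last_identity_column (K := K) (i := e) hD (by omega) hβ
      (a := k - (K - D - lam K D (2 * e))) (by omega)
    rw [h0, Nat.sub_zero, Nat.add_sub_cancel' h1] at hkb
    have hrow : K - lam K D (2 * e) + (k - (K - D - lam K D (2 * e))) = k + D := by omega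
    conv_lhs => rw [hkb, sym_eq_tail_left hD hDK (by omega) hb, hba, hrow, ← hkb, nuSelf]
    ring
  · have hodd : Odd (len K D) := ⟨e, he⟩
    have hc : ceilHalf K D = e + 1 := by rw [ceilHalf]; omega
    rw [nuLast, if_pos hodd, hc]
    rw [he] at h0 h1
    change K - D - lamPred K D (2 * (e + 1)) ≤ k at h1
    change lam K D (2 * (e + 1)) = 0 at h0
    obtain ⟨b, rfl⟩ := Nat.exists_eq_add_of_le h1
    have h4 := lamPred_two_mul_le (K := K) (i := e + 1) hD (by omega)
    rw [sym_eq_tail hD hDK (by omega) (by omega), h0, Finset.sum_range_zero, add_zero, nuSelf]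

theorem dependsOn_nuLast (hD : 1 ≤ D) (k : ℕ) :
    DependsOn (nuLast (F := F) K D k) (sideInfo K D k) := by
  intro x y h
  have hnu := dependsOn_nu (F := F) hD (two_mul_le_of_le_ceilHalf (K := K) le_rfl) le_rfl
    (Nat.le_add_right k _) h
  rw [nuLast, nuLast, hnu, msg_eq_of_sideInfo h (by omega : k < k + D) le_rfl]

theorem sym_eq_nuRest {k : ℕ} (hDK : D < K) (hk : k < K) (x : Fin K → F) :
    sym K D x (k % (K - D)) = msg x k + nuRest K D (k % (K - D)) k x := by
  have hN : 0 < K - D := by omega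
  rw [sym, dif_pos (Nat.mod_lt _ hN), code, Matrix.vecMul, dotProduct,
    Finset.sum_eq_add_sum_sdiff_singleton_of_mem (Finset.mem_univ (⟨k, hk⟩ : Fin K))]
  have hmsg : msg x k = x ⟨k, hk⟩ := by
    rw [msg]
    congr 1
    exact Fin.ext (Nat.mod_eq_of_lt hk)
  congr 1
  · rw [airMatrix, Matrix.of_apply, entry_column_mod hN hk le_rfl, hmsg]
    simp
  · rw [nuRest, Finset.sum_filter,
      ← Finset.sum_subset (Finset.subset_univ (Finset.univ \ {⟨k, hk⟩}))]
    · refine Finset.sum_congr rfl fun j hj => ?_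
      have hjk : (j : ℕ) ≠ k := by
        intro h
        simp [Fin.ext_iff, h] at hj
      rw [airMatrix, Matrix.of_apply]
      rcases entry_eq_zero_or_one K (K - D) j (k % (K - D)) with h | h <;> simp [h, hjk]
    · intro j _ hj
      have hjk : (j : ℕ) = k := by simpa [Fin.ext_iff] using hj
      simp [hjk]

/-- A row `j < k` with a `1` in column `k % (K - D)` is congruent to `k` modulo `K - D`, hence at
most `k - (K - D)`, which is where the side-information, read modulo `K`, ends. -/
theorem dependsOn_nuRest (hDK : D < K) {k : ℕ} (h1 : K - D ≤ k) (hk : k < K) :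
    DependsOn (nuRest (F := F) K D (k % (K - D)) k) (sideInfo K D k) := by
  intro x y h
  refine Finset.sum_congr rfl fun j hj => h j ?_
  rw [Finset.mem_filter] at hj
  obtain ⟨-, hj1, hjk⟩ := hj
  have hjK := j.isLt
  rcases Nat.lt_or_gt_of_ne hjk with hlt | hgt
  · rw [entry_column_mod (by omega) hk hlt.le] at hj1
    have hmod : (j : ℕ) ≡ k [MOD K - D] := by
      by_contra hne
      rw [if_neg (show ¬ (j : ℕ) % (K - D) = k % (K - D) from hne)] at hj1
      exact zero_ne_one hj1
    have hle := hmod.add_le_of_lt hlt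
    refine ⟨K + j - k, by omega, by omega, Fin.ext ?_⟩
    have h2 : k + (K + j - k) = K + j := by omega
    rw [h2, Fin.val_ofNat, Nat.add_mod_left, Nat.mod_eq_of_lt hjK]
  · refine ⟨j - k, by omega, by omega, Fin.ext ?_⟩
    rw [Nat.add_sub_cancel' hgt.le, Fin.val_ofNat, Nat.mod_eq_of_lt hjK]

end Decoding

end AIR

/-! ### The four kinds of receivers -/

open AIR
theorem theorem2 (F : Type*) [Field F] (K D : ℕ) [NeZero K] (hD : 1 ≤ D) (hDK : D < K) :
    -- every receiver falls in one of the four cases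
    (∀ k < K, (∃ i ≤ ceilHalf K D, k ∈ setD K D i) ∨ (∃ i < ceilHalf K D, k ∈ setE K D i) ∨
      (K - D - lam K D (len K D) ≤ k ∧ k < K - D) ∨ K - D ≤ k) ∧
    -- (i)
    (∀ i ≤ ceilHalf K D, ∀ k ∈ setD K D i,
      0 < dDown K D k ∧ 0 < mu K D k ∧ k + mu K D k < K - D ∧
      DependsOn (nu (F := F) K D i k) (sideInfo K D k) ∧
      DependsOn (nuSelf (F := F) K D i (k + mu K D k)) (sideInfo K D k) ∧
      ∀ x : Fin K → F,
        msg x k = sym K D x k - sym K D x (k + mu K D k)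
          - nu K D i k x + nuSelf K D i (k + mu K D k) x ∧
        (CharP F 2 → msg x k = sym K D x k + sym K D x (k + mu K D k)
          + (nu K D i k x + nuSelf K D i (k + mu K D k) x))) ∧
    -- (ii)
    (∀ i < ceilHalf K D, ∀ k ∈ setE K D i,
      0 < dDown K D k ∧ 0 < mu K D k ∧ k + mu K D k < K - D ∧
      (∀ r, k + t K D k r < K - D) ∧
      ∃ c d : ℕ, d < lam K D (2 * i + 1) ∧
        (k : ℤ) - ((K : ℤ) - D - lamPred K D (2 * i)) =
          ((beta K D (2 * i) : ℤ) - 1) * lam K D (2 * i) + c * lam K D (2 * i + 1) + d ∧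
        DependsOn (nu (F := F) K D i k) (sideInfo K D k) ∧
        DependsOn (nuSelfTail (F := F) K D i c (k + mu K D k)) (sideInfo K D k) ∧
        (∀ r, DependsOn (nuSelf (F := F) K D i (k + t K D k r)) (sideInfo K D k)) ∧
        ∀ x : Fin K → F,
          msg x k = sym K D x k - sym K D x (k + mu K D k) + ∑ r, sym K D x (k + t K D k r)
            - nu K D i k x + nuSelfTail K D i c (k + mu K D k) x
            - ∑ r, nuSelf K D i (k + t K D k r) x ∧
          (CharP F 2 →
            msg x k = sym K D x k + sym K D x (k + mu K D k) + ∑ r, sym K D x (k + t K D k r)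
              + (nu K D i k x + nuSelfTail K D i c (k + mu K D k) x
                + ∑ r, nuSelf K D i (k + t K D k r) x))) ∧
    -- (iii)
    (∀ k, K - D - lam K D (len K D) ≤ k → k < K - D →
      DependsOn (nuLast (F := F) K D k) (sideInfo K D k) ∧
      ∀ x : Fin K → F,
        msg x k = sym K D x k - nuLast K D k x ∧
        (CharP F 2 → msg x k = sym K D x k + nuLast K D k x)) ∧
    -- (iv)
    (∀ k, K - D ≤ k → k < K →
      DependsOn (nuRest (F := F) K D (k % (K - D)) k) (sideInfo K D k) ∧
      ∀ x : Fin K → F,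
        msg x k = sym K D x (k % (K - D)) - nuRest K D (k % (K - D)) k x ∧
        (CharP F 2 → msg x k =
          sym K D x (k % (K - D)) + nuRest K D (k % (K - D)) k x)) := by
  refine ⟨fun k _ => cases_cover hD hDK k, ?_, ?_, ?_, ?_⟩
  · intro i hi k hk
    obtain ⟨b, hkb, hb⟩ := exists_of_mem_setD hD hi hk
    have hi' := two_mul_le_of_le_ceilHalf hi
    have hpos : 0 < lam K D (2 * i) := Nat.pos_of_ne_zero fun h => by simp [h] at hb
    have h1 := lamPred_eq K D (2 * i)
    have h2 := lamPred_two_mul_le (K := K) hD hi'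
    have hlam := lam_le (K := K) hD hi'
    have hdown := add_dDown_tail_left hD hDK hi' (b := b) (by omega)
    have hmu := mu_of_lt hD hDK hi' hb
    rw [← hkb] at hdown hmu
    rw [hmu]
    refine ⟨by omega, hpos, by omega, dependsOn_nu hD hi' le_rfl (by omega),
      dependsOn_nuSelf hD hi' (by omega) le_rfl, fun x => ?_⟩
    have e1 := sym_eq_tail_left hD hDK hi' (b := b) (by omega) x
    have e2 := sym_eq_tail_left hD hDK hi' hb x
    rw [← hkb] at e1
    rw [← add_assoc, ← hkb, Nat.add_mod_right] at e2
    have h : msg x k = sym K D x k - sym K D x (k + lam K D (2 * i))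
        - nu K D i k x + nuSelf K D i (k + lam K D (2 * i)) x := by
      rw [e1, e2, nuSelf]
      ring
    refine ⟨h, fun _ => ?_⟩
    simp only [CharTwo.sub_eq_add] at h
    rw [h]
    ring
  · intro i hi k hk
    obtain ⟨hβ, a, ha, hka⟩ := exists_of_mem_setE hD hDK hi hk
    have hi' := two_mul_lt_of_lt_ceilHalf hi
    have hpos : 0 < lam K D (2 * i + 1) := lam_pos hD hi'
    have hlam := lam_le (K := K) (i := 2 * i) hD (by omega)
    have hd := Nat.mod_lt a hpos
    have hda := Nat.div_add_mod' a (lam K D (2 * i + 1))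
    have h1 := lamPred_eq K D (2 * i)
    have h2 := lamPred_two_mul_le (K := K) (i := i) hD (by omega)
    have hmu := add_mu_last hD hDK hi' hβ ha
    obtain ⟨b, hkb, hb, hba, hb'⟩ := last_identity_column (K := K) (i := i) hD (by omega) hβ ha
    have hdown := add_dDown_tail_left (i := i) hD hDK (by omega) hb
    rw [hba] at hdown
    rw [← hka] at hkb hmu
    rw [← hkb] at hdown
    have ht : ∀ s ∈ downSet K D k, 0 < s ∧ k + dDown K D k + s < K := fun s hs => by
      rw [downSet, Finset.mem_filter] at hs
      exact ⟨hs.2.1, hs.2.2.1⟩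
    have hlast : ∀ s ∈ downSet K D k, a + s < lam K D (2 * i) ∧ ∀ x : Fin K → F,
        sym K D x (k + s) = nuSelf K D i (k + s) x + msg x (k + dDown K D k + s) := fun s hs =>
      ⟨(sym_last hD hDK (by omega) hβ ha hka (ht s hs).2 (0 : Fin K → F)).1,
        fun x => (sym_last hD hDK (by omega) hβ ha hka (ht s hs).2 x).2⟩
    refine ⟨by omega, by omega, by omega, fun r => ?_, a / lam K D (2 * i + 1),
      a % lam K D (2 * i + 1), hd, ?_, dependsOn_nu hD (by omega) le_rfl (by omega),
      dependsOn_nuSelfTail hD hi' (by omega) (by omega), fun r => ?_, fun x => ?_⟩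
    · have := (hlast _ (t_mem_downSet K D k r)).1
      omega
    · rw [sub_one_mul, ← Nat.cast_mul, ← Nat.cast_mul]
      omega
    · have h3 := (hlast _ (t_mem_downSet K D k r)).1
      have h4 := (ht _ (t_mem_downSet K D k r)).1
      exact dependsOn_nuSelf hD (by omega) (by omega) (by omega)
    · have e1 := sym_eq_tail_left (i := i) hD hDK (by omega) hb x
      rw [← hkb, hba, ← hdown, nuSelf] at e1
      have e2 := sym_eq_nuSelfTail_add_sum hD hDK hi' hβ ha hka x
      have e3 : ∑ r, sym K D x (k + t K D k r) = ∑ r, nuSelf K D i (k + t K D k r) x +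
          ∑ s ∈ downSet K D k, msg x (k + dDown K D k + s) := by
        rw [sum_t K D k fun s => sym K D x (k + s), sum_t K D k fun s => nuSelf K D i (k + s) x,
          ← Finset.sum_add_distrib]
        exact Finset.sum_congr rfl fun s hs => (hlast s hs).2 x
      have h : msg x k = sym K D x k - sym K D x (k + mu K D k) + ∑ r, sym K D x (k + t K D k r)
          - nu K D i k x + nuSelfTail K D i (a / lam K D (2 * i + 1)) (k + mu K D k) x
          - ∑ r, nuSelf K D i (k + t K D k r) x := by
        rw [e1, e2, e3]
        ring
      refine ⟨h, fun _ => ?_⟩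
      simp only [CharTwo.sub_eq_add] at h
      rw [h]
      ring
  · intro k h1 h2
    refine ⟨dependsOn_nuLast hD k, fun x => ?_⟩
    have h : msg x k = sym K D x k - nuLast K D k x := by
      rw [sym_eq_nuLast hD hDK h1 h2, add_sub_cancel_right]
    exact ⟨h, fun _ => by rwa [CharTwo.sub_eq_add] at h⟩
  · intro k h1 h2
    refine ⟨dependsOn_nuRest hDK h1 h2, fun x => ?_⟩
    have h : msg x k = sym K D x (k % (K - D)) - nuRest K D (k % (K - D)) k x := by
      rw [sym_eq_nuRest hDK h2, add_sub_cancel_right]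
    exact ⟨h, fun _ => by rwa [CharTwo.sub_eq_add] at h⟩
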